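/- A hypergraph has a finite vertex set $V$ and a finite set of hyperedges, each a subset of $V$ with at least two elements. A cycle is a sequence $(v_0,e_1,v_1,e_2,\dots,e_m,v_m)$ with $m\ge 2$, $v_m=v_0$, $v_0,\dots,v_{m-1}$ distinct vertices, $e_1,\dots,e_m$ distinct hyperedges and $v_{i-1},v_i\in e_i$ for $1\le i\le m$. A hyperforest is a hypergraph without cycles; its connected components (isolated vertices included) are hypertrees. For weights $\mathbf w=(w_s)_{s\ge 2}$, let $$u_{n,p}(\mathbf w)=\sum_F\prod_{A\in F}w_{|A|},$$ where $F$ runs over the (edge sets of) spanning hyperforests with exactly $p$ connected components in the complete hypergraph on $n$ labelled vertices, whose hyperedges are all vertex subsets of cardinality at least $2$. Let $\mathbf e_k$ be the weight vector with $w_k=1$ and $w_s=0$ for $s\ne k$, so that $u_{n,p}(\mathbf e_k)$ is the number of unrooted spanning hyperforests with $p$ hypertrees in the complete $k$-uniform hypergraph on $n$ labelled vertices. (1) Let $k\ge 2$ and $p\ge 1$ be fixed integers. As $n\to\infty$ through the integers $n\ge p$ such that $k-1$ divides $n-p$, $$u_{n,p}(\mathbf e_k)\sim\binom{n-1}{p-1}\,\frac{(n-p)!}{\left(\frac{n-p}{k-1}\right)!}\,\frac{n^{\frac{n-p}{k-1}-1}}{[(k-1)!]^{\frac{n-p}{k-1}}}\left(\frac{k-1}{k}\right)^{p-1},$$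 that is, the ratio of the two sides tends to $1$. (2) For $p=1$ the formula is exact: for all $k\ge 2$ and all $n\ge 1$ such that $k-1$ divides $n-1$, $u_{n,1}(\mathbf e_k)$ equals the right-hand side of (1) with $p=1$. (3) For $k=2$ and $1\le p\le n$ the right-hand side of (1) equals $\binom{n-1}{p-1}\frac{n^{n-p-1}}{2^{p-1}}$; hence, for every fixed $p\ge 1$, as $n\to\infty$, $$u_{n,p}(\mathbf e_2)\sim\binom{n-1}{p-1}\,\frac{n^{n-p-1}}{2^{p-1}}.$$ -/

import Mathlib

open Filter Asymptotics

namespace Hyperforest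

/-! A hypergraph on the finite vertex type `V` is given by its finite set of hyperedges, which are
subsets of `V` with at least two elements. A spanning sub-hypergraph has the same vertices and is
identified with its set of hyperedges. -/

/-- `E` contains a cycle `(v₀, e₀, v₁, e₁, …, v_{m-1}, e_{m-1}, v_m)` of some length `m ≥ 2`:
a closed walk with `m` distinct vertices `v₀, …, v_{m-1}`, with `v_m = v₀`, and with `m` distinct
hyperedges. -/
def HasCycle {V : Type*} (E : Finset (Finset V)) : Prop :=
  ∃ (m : ℕ) (v : ℕ → V) (e : ℕ → Finset V), 2 ≤ m ∧
    Set.InjOn v (Set.Iio m) ∧ v m = v 0 ∧ Set.InjOn e (Set.Iio m) ∧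
    ∀ i < m, e i ∈ E ∧ v i ∈ e i ∧ v (i + 1) ∈ e i

/-- A hyperforest is a hypergraph without cycles. -/
def IsHyperforest {V : Type*} (E : Finset (Finset V)) : Prop := ¬ HasCycle E

/-- The equivalence relation on the vertices of being connected by a walk, in which any two
consecutive vertices lie in a common hyperedge. -/
def walkSetoid {V : Type*} (E : Finset (Finset V)) : Setoid V where
  r := Relation.ReflTransGen fun a b => ∃ A ∈ E, a ∈ A ∧ b ∈ A
  iseqv :=
    { refl := fun _ => Relation.ReflTransGen.refl
      symm := fun {x y} h => by
        induction h with
        | refl => exact Relation.ReflTransGen.refl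
        | tail _ h ih =>
          obtain ⟨A, hA, ha, hb⟩ := h
          exact Relation.ReflTransGen.head ⟨A, hA, hb, ha⟩ ih
      trans := fun h₁ h₂ => Relation.ReflTransGen.trans h₁ h₂ }

/-- The number of connected components of the spanning hypergraph with hyperedge set `E`
(isolated vertices are components). -/
noncomputable def numComponents {V : Type*} (E : Finset (Finset V)) : ℕ :=
  Nat.card (Quotient (walkSetoid E))

/-- The hyperedges of the hypergraph on `n` labelled vertices that is complete in the hyperedges
of all cardinalities `2 ≤ s ≤ n`. -/
def completeHyperedges (n : ℕ) : Finset (Finset (Fin n)) :=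
  Finset.univ.filter fun A => 2 ≤ A.card

open Classical in
/-- `u_{n,p}(w)`: the total weight of the unrooted spanning hyperforests of the complete hypergraph
on `n` vertices that consist of `p` hypertrees, each hyperedge of cardinality `s` having
weight `w s`. -/
noncomputable def unrootedWeight (n p : ℕ) (w : ℕ → ℝ) : ℝ :=
  ∑ F ∈ (completeHyperedges n).powerset with IsHyperforest F ∧ numComponents F = p,
    ∏ A ∈ F, w A.card

/-- The weight vector `e_k`: weight `1` on cardinality `k` and `0` on every other cardinality. -/
def basisWeight (k : ℕ) : ℕ → ℝ := Pi.single k 1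

/-- The expression
`C(n-1, p-1) * (n-p)! / ℓ! * n ^ (ℓ-1) / ((k-1)!) ^ ℓ * ((k-1)/k) ^ (p-1)`,
`ℓ = (n-p)/(k-1)`, used only for `k ≥ 2`, `1 ≤ p ≤ n` and `k - 1 ∣ n - p`. The exponent `ℓ - 1` is
an integer (it is `-1` for `n = p`). -/
noncomputable def leadingTerm (k p n : ℕ) : ℝ :=
  ((n - 1).choose (p - 1) : ℝ)
    * (((n - p).factorial : ℝ) / (((n - p) / (k - 1)).factorial : ℝ))
    * ((n : ℝ) ^ ((((n - p) / (k - 1) : ℕ) : ℤ) - 1)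
        / ((k - 1).factorial : ℝ) ^ ((n - p) / (k - 1)))
    * (((k : ℝ) - 1) / (k : ℝ)) ^ (p - 1)

end Hyperforest

/-! Put `k = q + 1` and `n = p + q m`; a `(q + 1)`-uniform hyperforest then has `p` components
exactly when it has `m` edges. Let `R(r, m)` (`rootedCount`) count hyperforests with `m` edges and
`r` roots in distinct components, so that `R(1, m)` is `n` times the number sought.

If every component is rooted, gluing a vertex `v` to `q` roots outside its component yields a
recursion in `m` (`rootedCount_transversal_rec`), hence a closed form (`rootedCount_transversal`).

If `d > 0` components lack a root, counting the vertices outside the rooted components in two ways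
gives `d R(r, m) = (r + 1) R(r + 1, m) - q C(r + q + 1, q + 1) R(r + q + 1, m - 1)`
(`rootedCount_rec`). Both terms on the right have `d - 1` unrooted components. Iterating from `r =
1`, `d = p - 1` expresses `R(1, m)` as a binomial sum of closed forms, that is, the leading term
times `correction`. For `p = 1` this factor is `1`; for fixed `p` it tends to `1` because `m / n → 1
/ q`. -/

namespace Hyperforest

/-! ### Walks, cycles and the insertion of a hyperedge -/

variable {V : Type*}

/-- Being connected by a walk in the hypergraph with edge set `E`. -/
abbrev Joined (E : Finset (Finset V)) : V → V → Prop :=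
  Relation.ReflTransGen fun a b => ∃ A ∈ E, a ∈ A ∧ b ∈ A

theorem Joined.symm {E : Finset (Finset V)} {a b : V} (h : Joined E a b) : Joined E b a :=
  (walkSetoid E).symm h

theorem Joined.mono {E E' : Finset (Finset V)} (hE : E ⊆ E') {a b : V} (h : Joined E a b) :
    Joined E' a b :=
  Relation.ReflTransGen.mono (fun _ _ ⟨A, hA, h⟩ => ⟨A, hE hA, h⟩) _ _ h

theorem joined_empty_iff {a b : V} : Joined (∅ : Finset (Finset V)) a b ↔ a = b := by
  constructor
  · intro h
    obtain h | ⟨_, _, A, hA, _⟩ := Relation.ReflTransGen.cases_tail h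
    · exact h.symm
    · simp at hA
  · rintro rfl
    exact Relation.ReflTransGen.refl

theorem joined_of_steps {E : Finset (Finset V)} {v : ℕ → V} {i j : ℕ} (hij : i ≤ j)
    (h : ∀ t, i ≤ t → t < j → ∃ A ∈ E, v t ∈ A ∧ v (t + 1) ∈ A) : Joined E (v i) (v j) := by
  induction j, hij using Nat.le_induction with
  | base => exact Relation.ReflTransGen.refl
  | succ j hij ih =>
    exact (ih fun t h1 h2 => h t h1 (h2.trans j.lt_succ_self)).tail (h j hij j.lt_succ_self)

/-- A walk of length `L` from `a` to `b`, with vertices `v` and edges `e`. -/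
def IsWalk (E : Finset (Finset V)) (a b : V) (L : ℕ) (v : ℕ → V) (e : ℕ → Finset V) : Prop :=
  v 0 = a ∧ v L = b ∧ ∀ i < L, e i ∈ E ∧ v i ∈ e i ∧ v (i + 1) ∈ e i

theorem exists_isWalk {E : Finset (Finset V)} {a b : V} (h : Joined E a b) :
    ∃ L v e, IsWalk E a b L v e := by
  induction h with
  | refl => exact ⟨0, fun _ => a, fun _ => ∅, rfl, rfl, by simp⟩
  | @tail b c _ h ih =>
    obtain ⟨L, v, e, h0, hL, hs⟩ := ih
    obtain ⟨A, hA, hb, hc⟩ := h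
    refine ⟨L + 1, fun t => if t ≤ L then v t else c, fun t => if t < L then e t else A,
      by simpa using h0, by simp, fun i hi => ?_⟩
    rcases Nat.lt_succ_iff_lt_or_eq.1 hi with h | rfl
    · simpa [h, h.le, Nat.succ_le_of_lt h] using hs i h
    · simpa [hL] using ⟨hA, hb, hc⟩

/-- A shortest walk visits no vertex twice and uses no edge twice. -/
theorem exists_isWalk_injOn {E : Finset (Finset V)} {a b : V} (h : Joined E a b) :
    ∃ L v e, IsWalk E a b L v e ∧ Set.InjOn v (Set.Iic L) ∧ Set.InjOn e (Set.Iio L) := by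
  classical
  have hex : ∃ L, ∃ v e, IsWalk E a b L v e := exists_isWalk h
  obtain ⟨v, e, hw⟩ := Nat.find_spec hex
  have hmin := fun L' => @Nat.find_min' _ _ hex L'
  generalize Nat.find hex = L at *
  obtain ⟨h0, hL, hs⟩ := hw
  -- If `v i = v j`, cutting out the segment between them shortens the walk by `j - i`.
  have hv : ∀ i j, i < j → j ≤ L → v i ≠ v j := by
    intro i j hij hj hv
    have := hmin (L - (j - i)) ⟨fun t => if t ≤ i then v t else v (t + (j - i)),
      fun t => if t < i then e t else e (t + (j - i)), by simpa using h0, ?_, fun t ht => ?_⟩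
    · omega
    · by_cases hh : L - (j - i) ≤ i
      · have : j = L := by omega
        have h3 : L - (j - i) = i := by omega
        simp only [h3, le_refl, if_true]
        rw [hv, this, hL]
      · simp only [hh, if_false]
        rw [← hL]; congr 1; omega
    · rcases lt_trichotomy t i with h | rfl | h
      · have := hs t (by omega)
        simpa [h, h.le, Nat.succ_le_of_lt h] using this
      · have := hs (t + (j - t)) (by omega)
        have h3 : t + (j - t) = j := by omega
        have h4 : t + 1 + (j - t) = j + 1 := by omega
        simpa [h3, h4, hv] using this
      · have := hs (t + (j - i)) (by omega)
        have h4 : t + (j - i) + 1 = t + 1 + (j - i) := by omega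
        have h5 : ¬ t ≤ i := by omega
        have h6 : ¬ t < i := by omega
        have h7 : ¬ t + 1 ≤ i := by omega
        simpa [h4, h5, h6, h7] using this
  -- If `e i = e j`, this edge leads directly from `v i` to `v (j + 1)`, which again saves `j - i`
  -- steps.
  have he : ∀ i j, i < j → j < L → e i ≠ e j := by
    intro i j hij hj he
    have := hmin (L - (j - i)) ⟨fun t => if t ≤ i then v t else v (t + (j - i)),
      fun t => if t ≤ i then e t else e (t + (j - i)), by simpa using h0, ?_, fun t ht => ?_⟩
    · omega
    · have hh : ¬ L - (j - i) ≤ i := by omega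
      simp only [hh, if_false]
      rw [← hL]; congr 1; omega
    · rcases lt_trichotomy t i with h | rfl | h
      · have := hs t (by omega)
        simpa [h, h.le, Nat.succ_le_of_lt h] using this
      · have h1 := hs t (by omega)
        have h2 := hs j (by omega)
        have h4 : t + 1 + (j - t) = j + 1 := by omega
        simpa [h4] using ⟨h1.1, h1.2.1, he ▸ h2.2.2⟩
      · have := hs (t + (j - i)) (by omega)
        have h4 : t + (j - i) + 1 = t + 1 + (j - i) := by omega
        have h5 : ¬ t ≤ i := by omega
        have h7 : ¬ t + 1 ≤ i := by omega
        simpa [h4, h5, h7] using this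
  refine ⟨L, v, e, ⟨h0, hL, hs⟩, fun i hi j hj hij => ?_, fun i hi j hj hij => ?_⟩
  · rcases lt_trichotomy i j with h | h | h
    · exact absurd hij (hv i j h hj)
    · exact h
    · exact absurd hij.symm (hv j i h hi)
  · rcases lt_trichotomy i j with h | h | h
    · exact absurd hij (he i j h hj)
    · exact h
    · exact absurd hij.symm (he j i h hi)

/-- `S` has at most one vertex in every connected component. -/
def Separated (E : Finset (Finset V)) (S : Finset V) : Prop :=
  ∀ a ∈ S, ∀ b ∈ S, Joined E a b → a = b

theorem Separated.anti {E E' : Finset (Finset V)} {S : Finset V} (h : Separated E' S)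
    (hE : E ⊆ E') : Separated E S :=
  fun a ha b hb hab => h a ha b hb (hab.mono hE)

theorem Separated.subset {E : Finset (Finset V)} {S T : Finset V} (h : Separated E T)
    (hS : S ⊆ T) : Separated E S :=
  fun a ha b hb hab => h a (hS ha) b (hS hb) hab

theorem Separated.notMem_edges {E : Finset (Finset V)} {A : Finset V} (h : Separated E A)
    (hA : 2 ≤ A.card) : A ∉ E := by
  intro hAE
  obtain ⟨a, ha, b, hb, hab⟩ := Finset.one_lt_card.1 hA
  exact hab (h a ha b hb (Relation.ReflTransGen.single ⟨A, hAE, ha, hb⟩))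

theorem HasCycle.mono {E E' : Finset (Finset V)} (hE : E ⊆ E') (h : HasCycle E) : HasCycle E' := by
  obtain ⟨m, v, e, hm, hv, hvm, he, hs⟩ := h
  exact ⟨m, v, e, hm, hv, hvm, he, fun i hi => ⟨hE (hs i hi).1, (hs i hi).2⟩⟩

theorem isHyperforest_empty : IsHyperforest (∅ : Finset (Finset V)) := by
  rintro ⟨m, v, e, hm, -, -, -, hs⟩
  simpa using (hs 0 (by omega)).1

variable [DecidableEq V]

/-- A shortest walk from `a` to `b` is closed up by `A`, which differs from all its edges; `a ≠ b`
makes the cycle length `L + 1` at least `2`. -/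
theorem hasCycle_insert_of_joined {E : Finset (Finset V)} {A : Finset V} (hA : A ∉ E) {a b : V}
    (ha : a ∈ A) (hb : b ∈ A) (hab : a ≠ b) (h : Joined E a b) : HasCycle (insert A E) := by
  obtain ⟨L, v, e, ⟨h0, hL, hs⟩, hv, he⟩ := exists_isWalk_injOn h
  have hL0 : L ≠ 0 := by
    rintro rfl
    exact hab (h0.symm.trans hL)
  refine ⟨L + 1, fun t => if t ≤ L then v t else a, fun t => if t < L then e t else A, by omega,
    fun i hi j hj hij => ?_, by simp [h0], fun i hi j hj hij => ?_, fun i hi => ?_⟩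
  · have hi' : i ≤ L := Nat.lt_succ_iff.1 hi
    have hj' : j ≤ L := Nat.lt_succ_iff.1 hj
    simp only [hi', hj', if_true] at hij
    exact hv hi' hj' hij
  · have hi' : i ≤ L := Nat.lt_succ_iff.1 hi
    have hj' : j ≤ L := Nat.lt_succ_iff.1 hj
    by_cases h1 : i < L <;> by_cases h2 : j < L <;> simp only [h1, h2, if_true, if_false] at hij
    · exact he h1 h2 hij
    · exact absurd (hij ▸ (hs i h1).1) hA
    · exact absurd (hij ▸ (hs j h2).1) hA
    · omega
  · rcases Nat.lt_succ_iff_lt_or_eq.1 hi with h | rfl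
    · have := hs i h
      simpa [h, h.le, Nat.succ_le_of_lt h] using ⟨Or.inr this.1, this.2⟩
    · simp [hL, hb, ha]

/-- Adding an edge to a hyperforest gives a hyperforest exactly if its vertices lie in distinct
components. -/
theorem isHyperforest_insert_iff {E : Finset (Finset V)} {A : Finset V} (hA : A ∉ E) :
    IsHyperforest (insert A E) ↔ IsHyperforest E ∧ Separated E A := by
  constructor
  · intro h
    refine ⟨fun hc => h (hc.mono (Finset.subset_insert _ _)), fun a ha b hb hab => ?_⟩
    by_contra hne
    exact h (hasCycle_insert_of_joined hA ha hb hne hab)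
  · rintro ⟨hE, hsep⟩ ⟨m, v, e, hm, hv, hvm, he, hs⟩
    -- The cycle must use `A`, and only once; the rest of it joins the two ends of that step inside
    -- `E`, so separation identifies them.
    obtain ⟨i, hi, hei⟩ : ∃ i < m, e i ∉ E := by
      by_contra! hcon
      exact hE ⟨m, v, e, hm, hv, hvm, he, fun i hi => ⟨hcon i hi, (hs i hi).2⟩⟩
    have hiA : e i = A := (Finset.mem_insert.1 (hs i hi).1).resolve_right hei
    have hstep : ∀ t < m, t ≠ i → ∃ B ∈ E, v t ∈ B ∧ v (t + 1) ∈ B := by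
      intro t ht hti
      refine ⟨e t, (Finset.mem_insert.1 (hs t ht).1).resolve_left fun h => ?_, (hs t ht).2⟩
      exact hti (he ht hi (h.trans hiA.symm))
    have h1 : Joined E (v (i + 1)) (v m) :=
      joined_of_steps hi fun t h1 h2 => hstep t h2 (by omega)
    have h2 : Joined E (v 0) (v i) :=
      joined_of_steps (Nat.zero_le i) fun t h1 h2 => hstep t (by omega) (by omega)
    have h3 : v (i + 1) = v i :=
      hsep _ (hiA ▸ (hs i hi).2.2) _ (hiA ▸ (hs i hi).2.1) (h1.trans (hvm ▸ h2))
    -- The last step `i + 1 = m` wraps around to `v 0`; there `v i = v 0` would force `m = 1`.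
    rcases Nat.lt_or_ge (i + 1) m with h | h
    · have := hv h hi h3
      omega
    · have him : i + 1 = m := by omega
      have := hv (show 0 < m by omega) hi (by rw [← h3, him, hvm])
      omega

theorem joined_insert_iff {E : Finset (Finset V)} {A : Finset V} {x y : V} :
    Joined (insert A E) x y ↔
      Joined E x y ∨ ∃ a ∈ A, ∃ b ∈ A, Joined E x a ∧ Joined E b y := by
  constructor
  · intro h
    induction h with
    | refl => exact Or.inl Relation.ReflTransGen.refl
    | @tail y z _ h ih =>
      obtain ⟨B, hB, hy, hz⟩ := h
      rcases Finset.mem_insert.1 hB with rfl | hB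
      · rcases ih with ih | ⟨a, ha, b, hb, hxa, -⟩
        · exact Or.inr ⟨y, hy, z, hz, ih, Relation.ReflTransGen.refl⟩
        · exact Or.inr ⟨a, ha, z, hz, hxa, Relation.ReflTransGen.refl⟩
      · rcases ih with ih | ⟨a, ha, b, hb, hxa, hby⟩
        · exact Or.inl (ih.tail ⟨B, hB, hy, hz⟩)
        · exact Or.inr ⟨a, ha, b, hb, hxa, hby.tail ⟨B, hB, hy, hz⟩⟩
  · rintro (h | ⟨a, ha, b, hb, h1, h2⟩)
    · exact h.mono (Finset.subset_insert _ _)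
    · exact ((h1.mono (Finset.subset_insert _ _)).tail
        ⟨A, Finset.mem_insert_self _ _, ha, hb⟩).trans (h2.mono (Finset.subset_insert _ _))

end Hyperforest

/-! ### Component sizes and separated sets -/

namespace Hyperforest

variable {V : Type*} [Fintype V] [DecidableEq V]

open Classical in
/-- The set of vertices connected to a vertex of `S`. -/
noncomputable def reach (E : Finset (Finset V)) (S : Finset V) : Finset V :=
  Finset.univ.filter fun v => ∃ s ∈ S, Joined E s v

omit [DecidableEq V] in
theorem mem_reach {E : Finset (Finset V)} {S : Finset V} {v : V} :
    v ∈ reach E S ↔ ∃ s ∈ S, Joined E s v := by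
  simp [reach]

/-- Each edge of a reached component accounts for `q` vertices besides its point of attachment. In
the induction an edge meeting the reached set at `a` is traded for its other `q` vertices as
additional roots, hence the generalization over `S`. -/
theorem card_reach {q : ℕ} (E : Finset (Finset V)) (hE : IsHyperforest E)
    (hcard : ∀ A ∈ E, A.card = q + 1) (S : Finset V) (hS : Separated E S) :
    (reach E S).card = S.card + q * (E.filter fun A => ¬ Disjoint A (reach E S)).card := by
  induction E using Finset.induction_on generalizing S with
  | empty =>
    have : reach ∅ S = S := by
      ext v
      simp [mem_reach, joined_empty_iff]
    simp [this]
  | insert A E hA ih =>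
    obtain ⟨hE', hsep⟩ := (isHyperforest_insert_iff hA).1 hE
    have ih := ih hE' fun B hB => hcard B (Finset.mem_insert_of_mem hB)
    have hSE : Separated E S := hS.anti (Finset.subset_insert _ _)
    by_cases hdis : Disjoint A (reach E S)
    · have hr : reach (insert A E) S = reach E S := by
        ext v
        simp only [mem_reach, joined_insert_iff]
        constructor
        · rintro ⟨s, hs, h | ⟨a, ha, b, hb, h1, h2⟩⟩
          · exact ⟨s, hs, h⟩
          · exact absurd (mem_reach.2 ⟨s, hs, h1⟩) (Finset.disjoint_left.1 hdis ha)
        · rintro ⟨s, hs, h⟩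
          exact ⟨s, hs, Or.inl h⟩
      rw [hr, Finset.filter_insert, if_neg (not_not.2 hdis)]
      exact ih S hSE
    · obtain ⟨a, ha, hra⟩ := Finset.not_disjoint_iff.1 hdis
      obtain ⟨s, hs, hsa⟩ := mem_reach.1 hra
      -- Only one vertex of `A` is reached without `A`: a second one would come from the same root
      -- and violate the separation of `A`.
      have key : ∀ t ∈ S, ∀ b ∈ A, Joined E t b → b = a := by
        intro t ht b hb htb
        have : t = s := hS t ht s hs (joined_insert_iff.2 (Or.inr ⟨b, hb, a, ha, htb, hsa.symm⟩))
        subst this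
        exact hsep b hb a ha (htb.symm.trans hsa)
      have hr : reach (insert A E) S = reach E (S ∪ A.erase a) := by
        ext v
        simp only [mem_reach, joined_insert_iff, Finset.mem_union, Finset.mem_erase]
        constructor
        · rintro ⟨t, ht, h | ⟨a', ha', b, hb, h1, h2⟩⟩
          · exact ⟨t, Or.inl ht, h⟩
          · by_cases hba : b = a
            · exact ⟨s, Or.inl hs, hsa.trans (hba ▸ h2)⟩
            · exact ⟨b, Or.inr ⟨hba, hb⟩, h2⟩
        · rintro ⟨t, ht | ⟨hta, htA⟩, h⟩
          · exact ⟨t, ht, Or.inl h⟩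
          · exact ⟨s, hs, Or.inr ⟨a, ha, t, htA, hsa, h⟩⟩
      have hT : Separated E (S ∪ A.erase a) := by
        intro x hx y hy hxy
        rw [Finset.mem_union, Finset.mem_erase] at hx hy
        rcases hx with hx | ⟨hxa, hx⟩ <;> rcases hy with hy | ⟨hya, hy⟩
        · exact hSE x hx y hy hxy
        · exact absurd (key x hx y hy hxy) hya
        · exact absurd (key y hy x hx hxy.symm) hxa
        · exact hsep x hx y hy hxy
      have hd : Disjoint S (A.erase a) := by
        refine Finset.disjoint_left.2 fun x hx hxA => ?_
        rw [Finset.mem_erase] at hxA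
        exact hxA.1 (key x hx x hxA.2 Relation.ReflTransGen.refl)
      have hm : ¬ Disjoint A (reach E (S ∪ A.erase a)) :=
        Finset.not_disjoint_iff.2 ⟨a, ha, mem_reach.2 ⟨s, Finset.mem_union_left _ hs, hsa⟩⟩
      rw [hr, Finset.filter_insert, if_pos hm, ih _ hT, Finset.card_union_of_disjoint hd,
        Finset.card_erase_of_mem ha, hcard A (Finset.mem_insert_self _ _),
        Finset.card_insert_of_notMem (by simp [hA])]
      simp only [Nat.add_sub_cancel]
      ring

omit [DecidableEq V] in
theorem exists_transversal (E : Finset (Finset V)) :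
    ∃ S : Finset V, Separated E S ∧ S.card = numComponents E ∧ reach E S = Finset.univ := by
  classical
  refine ⟨Finset.univ.image (Quotient.out : Quotient (walkSetoid E) → V), ?_, ?_, ?_⟩
  · intro a ha b hb hab
    simp only [Finset.mem_image, Finset.mem_univ, true_and] at ha hb
    obtain ⟨x, rfl⟩ := ha
    obtain ⟨y, rfl⟩ := hb
    have hxy : x = y := by
      rw [← Quotient.out_eq x, ← Quotient.out_eq y]
      exact Quotient.sound hab
    rw [hxy]
  · rw [Finset.card_image_of_injective _ Quotient.out_injective, numComponents,
      Nat.card_eq_fintype_card, Finset.card_univ]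
  · refine Finset.eq_univ_iff_forall.2 fun v => mem_reach.2 ⟨_, Finset.mem_image_of_mem _
      (Finset.mem_univ (Quotient.mk (walkSetoid E) v)), Quotient.mk_out (s := walkSetoid E) v⟩

theorem card_eq_numComponents_add {q : ℕ} {E : Finset (Finset V)} (hE : IsHyperforest E)
    (hcard : ∀ A ∈ E, A.card = q + 1) :
    Fintype.card V = numComponents E + q * E.card := by
  obtain ⟨S, hS, hc, hr⟩ := exists_transversal E
  have h := card_reach E hE hcard S hS
  rw [hr, hc, Finset.filter_true_of_mem, Finset.card_univ] at h
  · exact h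
  · intro A hA
    rw [← Finset.top_eq_univ, disjoint_top, Finset.bot_eq_empty]
    rintro rfl
    simpa using hcard _ hA

omit [DecidableEq V] in
theorem reach_eq_univ {E : Finset (Finset V)} {S : Finset V} (hS : Separated E S)
    (hc : S.card = numComponents E) : reach E S = Finset.univ := by
  classical
  have hinj : Set.InjOn (Quotient.mk (walkSetoid E)) S := fun a ha b hb hab =>
    hS a ha b hb (Quotient.exact hab)
  have himg : S.image (Quotient.mk (walkSetoid E)) = Finset.univ := by
    refine Finset.eq_univ_of_card _ ?_
    rw [Finset.card_image_of_injOn hinj, hc, numComponents, Nat.card_eq_fintype_card]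
  refine Finset.eq_univ_iff_forall.2 fun v => mem_reach.2 ?_
  have hv : Quotient.mk (walkSetoid E) v ∈ S.image (Quotient.mk (walkSetoid E)) := by
    rw [himg]; exact Finset.mem_univ _
  obtain ⟨s, hs, h⟩ := Finset.mem_image.1 hv
  exact ⟨s, hs, Quotient.exact h⟩

open Classical in
/-- The `q + 1`-uniform hyperforests with `m` edges. -/
noncomputable def forests (V : Type*) [Fintype V] (q m : ℕ) : Finset (Finset (Finset V)) :=
  Finset.univ.filter fun F => IsHyperforest F ∧ (∀ A ∈ F, A.card = q + 1) ∧ F.card = m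

omit [DecidableEq V] in
theorem mem_forests {q m : ℕ} {F : Finset (Finset V)} :
    F ∈ forests V q m ↔ IsHyperforest F ∧ (∀ A ∈ F, A.card = q + 1) ∧ F.card = m := by
  simp [forests]

open Classical in
/-- The separated sets of `r` vertices. -/
noncomputable def sepSets (E : Finset (Finset V)) (r : ℕ) : Finset (Finset V) :=
  Finset.univ.filter fun S => Separated E S ∧ S.card = r

omit [DecidableEq V] in
theorem mem_sepSets {E : Finset (Finset V)} {r : ℕ} {S : Finset V} :
    S ∈ sepSets E r ↔ Separated E S ∧ S.card = r := by
  simp [sepSets]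

/-- Deleting a marked edge is inverse to inserting a separated set. As `q ≥ 1`, such a set has two
vertices and so is not yet an edge. -/
theorem sum_forests_succ {q m : ℕ} (hq : 1 ≤ q) (f : Finset (Finset V) → Finset V → ℕ) :
    ∑ F ∈ forests V q (m + 1), ∑ A ∈ F, f F A =
      ∑ F ∈ forests V q m, ∑ A ∈ sepSets F (q + 1), f (insert A F) A := by
  rw [Finset.sum_sigma', Finset.sum_sigma']
  refine Finset.sum_bij' (fun x _ => ⟨x.1.erase x.2, x.2⟩) (fun x _ => ⟨insert x.2 x.1, x.2⟩)
    ?_ ?_ ?_ ?_ ?_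
  · rintro ⟨F, A⟩ h
    simp only [Finset.mem_sigma, mem_forests, mem_sepSets] at h ⊢
    obtain ⟨⟨hF, hu, hm⟩, hA⟩ := h
    rw [← Finset.insert_erase hA, isHyperforest_insert_iff (Finset.notMem_erase _ _)] at hF
    exact ⟨⟨hF.1, fun B hB => hu B (Finset.mem_of_mem_erase hB),
      by rw [Finset.card_erase_of_mem hA, hm, Nat.add_sub_cancel]⟩, hF.2, hu A hA⟩
  · rintro ⟨F, A⟩ h
    simp only [Finset.mem_sigma, mem_forests, mem_sepSets] at h ⊢
    obtain ⟨⟨hF, hu, hm⟩, hsep, hA⟩ := h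
    have hn : A ∉ F := hsep.notMem_edges (by omega)
    refine ⟨⟨(isHyperforest_insert_iff hn).2 ⟨hF, hsep⟩, ?_, ?_⟩, Finset.mem_insert_self _ _⟩
    · intro B hB
      rcases Finset.mem_insert.1 hB with rfl | hB
      exacts [hA, hu B hB]
    · rw [Finset.card_insert_of_notMem hn, hm]
  · rintro ⟨F, A⟩ h
    simp only [Finset.mem_sigma] at h
    simp [Finset.insert_erase h.2]
  · rintro ⟨F, A⟩ h
    simp only [Finset.mem_sigma, mem_sepSets] at h
    simp [Finset.erase_insert (h.2.1.notMem_edges (by omega))]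
  · rintro ⟨F, A⟩ h
    simp only [Finset.mem_sigma] at h
    simp [Finset.insert_erase h.2]

end Hyperforest

/-! ### Double counting: the two recursions -/

namespace Hyperforest

variable {V : Type*} [Fintype V] [DecidableEq V]

/-- For separated `A` and `S`, avoiding the components of `S` means that `S ∪ A` is a disjoint union
and separated; the binomial coefficient chooses `A` inside the union. -/
theorem sum_card_disjoint_reach (E : Finset (Finset V)) (r k : ℕ) :
    ∑ A ∈ sepSets E k, ((sepSets E r).filter fun S => Disjoint A (reach E S)).card =
      (r + k).choose k * (sepSets E (r + k)).card := by
  have hrhs : ∑ T ∈ sepSets E (r + k), (T.powersetCard k).card =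
      (r + k).choose k * (sepSets E (r + k)).card := by
    rw [Finset.sum_congr rfl fun T hT => by
      rw [Finset.card_powersetCard, (mem_sepSets.1 hT).2], Finset.sum_const, smul_eq_mul, mul_comm]
  rw [← hrhs, ← Finset.card_sigma, ← Finset.card_sigma]
  have hdis : ∀ A S : Finset V, Disjoint A (reach E S) → Disjoint S A := fun A S h =>
    Finset.disjoint_left.2 fun x hx hxA =>
      Finset.disjoint_left.1 h hxA (mem_reach.2 ⟨x, hx, Relation.ReflTransGen.refl⟩)
  refine Finset.card_bij' (fun x _ => ⟨x.2 ∪ x.1, x.1⟩) (fun x _ => ⟨x.2, x.1 \ x.2⟩) ?_ ?_ ?_ ?_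
  · rintro ⟨A, S⟩ h
    simp only [Finset.mem_sigma, Finset.mem_filter, mem_sepSets, Finset.mem_powersetCard] at h ⊢
    obtain ⟨⟨hA, hAk⟩, ⟨hS, hSr⟩, hd⟩ := h
    refine ⟨⟨?_, ?_⟩, Finset.subset_union_right, hAk⟩
    · intro x hx y hy hxy
      rw [Finset.mem_union] at hx hy
      rcases hx with hx | hx <;> rcases hy with hy | hy
      · exact hS x hx y hy hxy
      · exact absurd (mem_reach.2 ⟨x, hx, hxy⟩) (Finset.disjoint_left.1 hd hy)
      · exact absurd (mem_reach.2 ⟨y, hy, hxy.symm⟩) (Finset.disjoint_left.1 hd hx)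
      · exact hA x hx y hy hxy
    · rw [Finset.card_union_of_disjoint (hdis A S hd), hSr, hAk]
  · rintro ⟨T, A⟩ h
    simp only [Finset.mem_sigma, Finset.mem_filter, mem_sepSets, Finset.mem_powersetCard] at h ⊢
    obtain ⟨⟨hT, hTc⟩, hAT, hAk⟩ := h
    refine ⟨⟨hT.subset hAT, hAk⟩, ⟨hT.subset Finset.sdiff_subset, ?_⟩, ?_⟩
    · rw [Finset.card_sdiff_of_subset hAT, hTc, hAk, Nat.add_sub_cancel]
    · refine Finset.disjoint_left.2 fun x hx hr => ?_
      obtain ⟨s, hs, hsx⟩ := mem_reach.1 hr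
      rw [Finset.mem_sdiff] at hs
      exact hs.2 (hT s hs.1 x (hAT hx) hsx ▸ hx)
  · rintro ⟨A, S⟩ h
    simp only [Finset.mem_sigma, Finset.mem_filter] at h
    simp [Finset.union_sdiff_cancel_right (hdis A S h.2.2)]
  · rintro ⟨T, A⟩ h
    simp only [Finset.mem_sigma, Finset.mem_powersetCard] at h
    simp [Finset.sdiff_union_of_subset h.2.1]

/-- An edge that misses the components of `S` leaves them unchanged, so the condition may be read
before or after its deletion. -/
theorem separated_insert_and_disjoint_iff {E : Finset (Finset V)} {A S : Finset V} :
    (Separated (insert A E) S ∧ Disjoint A (reach (insert A E) S)) ↔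
      (Separated E S ∧ Disjoint A (reach E S)) := by
  simp only [Finset.disjoint_left, mem_reach, joined_insert_iff]
  constructor
  · rintro ⟨hS, hd⟩
    exact ⟨hS.anti (Finset.subset_insert _ _), fun a ha ⟨s, hs, h⟩ => hd ha ⟨s, hs, Or.inl h⟩⟩
  · rintro ⟨hS, hd⟩
    refine ⟨fun x hx y hy hxy => ?_, fun a ha => ?_⟩
    · rcases joined_insert_iff.1 hxy with h | ⟨a, ha, b, hb, h1, h2⟩
      · exact hS x hx y hy h
      · exact absurd ⟨x, hx, h1⟩ (hd ha)
    · rintro ⟨s, hs, h | ⟨a', ha', b, hb, h1, h2⟩⟩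
      · exact hd ha ⟨s, hs, h⟩
      · exact hd ha' ⟨s, hs, h1⟩

/-- The number of `q + 1`-uniform hyperforests with `m` edges together with a separated set of `r`
vertices. -/
noncomputable def rootedCount (V : Type*) [Fintype V] (q r m : ℕ) : ℕ :=
  ∑ F ∈ forests V q m, (sepSets F r).card

/-- An unreached vertex is one further root: the case `k = 1` of `sum_card_disjoint_reach`. -/
theorem sum_card_compl_reach (E : Finset (Finset V)) (r : ℕ) :
    ∑ S ∈ sepSets E r, (reach E S)ᶜ.card = (r + 1) * (sepSets E (r + 1)).card := by
  have h := sum_card_disjoint_reach E r 1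
  rw [Nat.choose_one_right] at h
  have hcomm : ∑ A ∈ sepSets E 1, ((sepSets E r).filter fun S => Disjoint A (reach E S)).card =
      ∑ S ∈ sepSets E r, ((sepSets E 1).filter fun A => Disjoint A (reach E S)).card := by
    simp only [Finset.card_filter]
    exact Finset.sum_comm
  rw [← h, hcomm]
  refine Finset.sum_congr rfl fun S _ => Finset.card_bij (fun v _ => {v}) ?_ ?_ ?_
  · intro v hv
    rw [Finset.mem_compl] at hv
    simp only [Finset.mem_filter, mem_sepSets, Finset.card_singleton, and_true,
      Finset.disjoint_singleton_left]
    refine ⟨fun a ha b hb _ => ?_, hv⟩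
    rw [Finset.mem_singleton.1 ha, Finset.mem_singleton.1 hb]
  · intro v _ w _ h
    exact Finset.singleton_injective h
  · intro A hA
    simp only [Finset.mem_filter, mem_sepSets] at hA
    obtain ⟨v, rfl⟩ := Finset.card_eq_one.1 hA.1.2
    exact ⟨v, by simpa using hA.2, rfl⟩

theorem sum_card_disjoint_edges {q : ℕ} (hq : 1 ≤ q) (r m : ℕ) :
    ∑ F ∈ forests V q (m + 1), ∑ S ∈ sepSets F r,
      (F.filter fun A => Disjoint A (reach F S)).card =
      (r + (q + 1)).choose (q + 1) * rootedCount V q (r + (q + 1)) m := by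
  have hcomm : ∀ F : Finset (Finset V), ∑ S ∈ sepSets F r,
      (F.filter fun A => Disjoint A (reach F S)).card =
      ∑ A ∈ F, ((sepSets F r).filter fun S => Disjoint A (reach F S)).card := by
    intro F
    simp only [Finset.card_filter]
    exact Finset.sum_comm
  rw [Finset.sum_congr rfl fun F _ => hcomm F, sum_forests_succ hq, rootedCount, Finset.mul_sum]
  refine Finset.sum_congr rfl fun F _ => ?_
  rw [← sum_card_disjoint_reach]
  refine Finset.sum_congr rfl fun A _ => ?_
  congr 1
  ext S
  simp only [Finset.mem_filter, mem_sepSets]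
  have := separated_insert_and_disjoint_iff (E := F) (A := A) (S := S)
  tauto

/-- By `card_reach`, `n` is the sum of the number of unreached vertices, `r`, and `q` times the
number of edges meeting the reached set. Summed over all pairs, unreached vertices become new roots,
and each edge disjoint from the reached set is deleted, its `q + 1` vertices becoming roots. -/
theorem rootedCount_rec {q : ℕ} (hq : 1 ≤ q) (r m : ℕ) :
    (r + 1) * rootedCount V q (r + 1) (m + 1) + (r + q * (m + 1)) * rootedCount V q r (m + 1) =
      Fintype.card V * rootedCount V q r (m + 1) +
        q * ((r + (q + 1)).choose (q + 1) * rootedCount V q (r + (q + 1)) m) := by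
  rw [← sum_card_disjoint_edges hq]
  simp only [rootedCount, Finset.mul_sum]
  rw [← Finset.sum_add_distrib, ← Finset.sum_add_distrib]
  refine Finset.sum_congr rfl fun F hF => ?_
  obtain ⟨hF, hu, hm⟩ := mem_forests.1 hF
  have hconst : ∀ c, c * (sepSets F r).card = ∑ _S ∈ sepSets F r, c := by simp [mul_comm]
  rw [← sum_card_compl_reach, hconst, hconst, ← Finset.sum_add_distrib, ← Finset.sum_add_distrib]
  refine Finset.sum_congr rfl fun S hS => ?_
  obtain ⟨hS, hr⟩ := mem_sepSets.1 hS
  have h1 := card_reach F hF hu S hS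
  have h2 := Finset.card_compl_add_card (reach F S)
  have h3 := Finset.card_filter_add_card_filter_not (s := F) (fun A => Disjoint A (reach F S))
  rw [hm] at h3
  rw [← h2, h1, hr, ← h3]
  ring

/-- A transversal `T`, a vertex `v` and `q` elements of `T` not connected to `v` correspond to a new
edge and a transversal of the hyperforest enlarged by it. -/
theorem sum_card_sepSets_insert {q r : ℕ} {E : Finset (Finset V)}
    (hc : numComponents E = r + q)
    (hc' : ∀ A ∈ sepSets E (q + 1), numComponents (insert A E) = r) :
    ∑ A ∈ sepSets E (q + 1), (sepSets (insert A E) r).card =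
      Fintype.card V * (r + q - 1).choose q * (sepSets E (r + q)).card := by
  have hrhs : ∑ x ∈ sepSets E (r + q) ×ˢ (Finset.univ : Finset V),
      ((x.1.powersetCard q).filter fun B => x.2 ∉ reach E B).card =
      Fintype.card V * (r + q - 1).choose q * (sepSets E (r + q)).card := by
    rw [Finset.sum_congr rfl (g := fun _ => (r + q - 1).choose q)]
    · rw [Finset.sum_const, Finset.card_product, Finset.card_univ, smul_eq_mul]
      ring
    · rintro ⟨T, v⟩ h
      simp only [Finset.mem_product, mem_sepSets, Finset.mem_univ, and_true] at h
      obtain ⟨hT, hTc⟩ := h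
      have hv : v ∈ reach E T := by
        rw [reach_eq_univ hT (hTc.trans hc.symm)]; exact Finset.mem_univ v
      -- Exactly one root `t` lies in the component of `v`, so `B` is any `q`-subset of the other `r
      -- + q - 1` roots.
      obtain ⟨t, ht, htv⟩ := mem_reach.1 hv
      have : (T.powersetCard q).filter (fun B => v ∉ reach E B) = (T.erase t).powersetCard q := by
        ext B
        simp only [Finset.mem_filter, Finset.mem_powersetCard, Finset.subset_erase, mem_reach]
        constructor
        · rintro ⟨⟨h1, h2⟩, h3⟩
          exact ⟨⟨h1, fun h => h3 ⟨t, h, htv⟩⟩, h2⟩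
        · rintro ⟨⟨h1, h2⟩, h3⟩
          refine ⟨⟨h1, h3⟩, ?_⟩
          rintro ⟨b, hb, hbv⟩
          exact h2 (hT b (h1 hb) t ht (hbv.trans htv.symm) ▸ hb)
      rw [this, Finset.card_powersetCard, Finset.card_erase_of_mem ht, hTc]
  rw [← hrhs, ← Finset.card_sigma, ← Finset.card_sigma]
  symm
  -- The new edge is `{v} ∪ B`; the roots in `B` are given up, since their components merge with
  -- that of `v`.
  refine Finset.card_bij (fun x _ => ⟨insert x.1.2 x.2, x.1.1 \ x.2⟩) ?_ ?_ ?_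
  · rintro ⟨⟨T, v⟩, B⟩ h
    simp only [Finset.mem_sigma, Finset.mem_filter, mem_sepSets, Finset.mem_powersetCard,
      Finset.mem_product, Finset.mem_univ, and_true, mem_reach, not_exists, not_and] at h ⊢
    obtain ⟨⟨hT, hTc⟩, ⟨hBT, hBc⟩, hv⟩ := h
    have hvB : v ∉ B := fun h => hv v h Relation.ReflTransGen.refl
    refine ⟨⟨?_, by rw [Finset.card_insert_of_notMem hvB, hBc]⟩, ?_,
      by rw [Finset.card_sdiff_of_subset hBT, hTc, hBc, Nat.add_sub_cancel]⟩
    · intro x hx y hy hxy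
      rcases Finset.mem_insert.1 hx with hx' | hx' <;>
        rcases Finset.mem_insert.1 hy with hy' | hy'
      · rw [hx', hy']
      · exact absurd (hx' ▸ hxy.symm) (hv y hy')
      · exact absurd (hy' ▸ hxy) (hv x hx')
      · exact hT x (hBT hx') y (hBT hy') hxy
    · have key : ∀ s ∈ T \ B, ∀ a ∈ insert v B, Joined E s a → a = v := by
        intro s hs a ha hsa
        rw [Finset.mem_sdiff] at hs
        refine (Finset.mem_insert.1 ha).resolve_right fun h => hs.2 ?_
        exact hT s hs.1 a (hBT h) hsa ▸ h
      intro x hx y hy hxy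
      have hx' := (Finset.mem_sdiff.1 hx).1
      have hy' := (Finset.mem_sdiff.1 hy).1
      rcases joined_insert_iff.1 hxy with h | ⟨a, ha, b, hb, h1, h2⟩
      · exact hT x hx' y hy' h
      · have h3 := key x hx a ha h1
        have h4 := key y hy b hb h2.symm
        subst h3 h4
        exact hT x hx' y hy' (h1.trans h2)
  · rintro ⟨⟨T, v⟩, B⟩ h ⟨⟨T', v'⟩, B'⟩ h' heq
    simp only [Finset.mem_sigma, Finset.mem_filter, mem_sepSets, Finset.mem_powersetCard,
      Finset.mem_product, Finset.mem_univ, and_true, mem_reach, not_exists, not_and] at h h'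
    obtain ⟨⟨hT, hTc⟩, ⟨hBT, hBc⟩, hv⟩ := h
    obtain ⟨⟨hT', hTc'⟩, ⟨hBT', hBc'⟩, hv'⟩ := h'
    simp only [Sigma.mk.injEq, heq_eq_eq] at heq
    obtain ⟨he, hs⟩ := heq
    have hvB : v ∉ B := fun h => hv v h Relation.ReflTransGen.refl
    have hvB' : v' ∉ B' := fun h => hv' v' h Relation.ReflTransGen.refl
    -- The vertex `v` is recovered as the only one of the new edge that is joined in `E` to a
    -- surviving root.
    have hvv : v = v' := by
      have hvr : v ∈ reach E T := by
        rw [reach_eq_univ hT (hTc.trans hc.symm)]; exact Finset.mem_univ v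
      obtain ⟨t, ht, htv⟩ := mem_reach.1 hvr
      have htS : t ∈ T' \ B' := hs ▸ Finset.mem_sdiff.2 ⟨ht, fun h => hv t h htv⟩
      rw [Finset.mem_sdiff] at htS
      refine (Finset.mem_insert.1 (he ▸ Finset.mem_insert_self v B)).resolve_right fun h => ?_
      exact htS.2 (hT' t htS.1 v (hBT' h) htv ▸ h)
    subst hvv
    have hBB : B = B' := by
      rw [← Finset.erase_insert hvB, he, Finset.erase_insert hvB']
    subst hBB
    have hTT : T = T' := by
      rw [← Finset.sdiff_union_of_subset hBT, hs, Finset.sdiff_union_of_subset hBT']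
    rw [hTT]
  · rintro ⟨A, S⟩ h
    simp only [Finset.mem_sigma, mem_sepSets] at h
    obtain ⟨⟨hA, hAc⟩, hS, hSc⟩ := h
    have hSE : Separated E S := hS.anti (Finset.subset_insert _ _)
    obtain ⟨v, hvA, s, hs, hsv⟩ : ∃ v ∈ A, ∃ s ∈ S, Joined E s v := by
      obtain ⟨a, ha⟩ := Finset.card_pos.1 (show 0 < A.card by omega)
      have har : a ∈ reach (insert A E) S := by
        rw [reach_eq_univ hS (hSc.trans (hc' A (mem_sepSets.2 ⟨hA, hAc⟩)).symm)]
        exact Finset.mem_univ a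
      obtain ⟨s, hs, hsa⟩ := mem_reach.1 har
      rcases joined_insert_iff.1 hsa with h | ⟨b, hb, c, hc, h1, h2⟩
      · exact ⟨a, ha, s, hs, h⟩
      · exact ⟨b, hb, s, hs, h1⟩
    have key : ∀ t ∈ S, ∀ b ∈ A, Joined E t b → b = v := by
      intro t ht b hb htb
      have : t = s := hS t ht s hs (joined_insert_iff.2 (Or.inr ⟨b, hb, v, hvA, htb, hsv.symm⟩))
      subst this
      exact hA b hb v hvA (htb.symm.trans hsv)
    have hd : Disjoint S (A.erase v) := by
      refine Finset.disjoint_left.2 fun x hx hxA => ?_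
      rw [Finset.mem_erase] at hxA
      exact hxA.1 (key x hx x hxA.2 Relation.ReflTransGen.refl)
    refine ⟨⟨⟨S ∪ A.erase v, v⟩, A.erase v⟩, ?_, ?_⟩
    · simp only [Finset.mem_sigma, Finset.mem_filter, mem_sepSets, Finset.mem_powersetCard,
        Finset.mem_product, Finset.mem_univ, and_true, mem_reach, not_exists, not_and]
      refine ⟨⟨?_, ?_⟩, ⟨Finset.subset_union_right, ?_⟩, ?_⟩
      · intro x hx y hy hxy
        rw [Finset.mem_union, Finset.mem_erase] at hx hy
        rcases hx with hx | ⟨hxa, hx⟩ <;> rcases hy with hy | ⟨hya, hy⟩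
        · exact hSE x hx y hy hxy
        · exact absurd (key x hx y hy hxy) hya
        · exact absurd (key y hy x hx hxy.symm) hxa
        · exact hA x hx y hy hxy
      · rw [Finset.card_union_of_disjoint hd, Finset.card_erase_of_mem hvA, hSc, hAc,
          Nat.add_sub_cancel]
      · rw [Finset.card_erase_of_mem hvA, hAc, Nat.add_sub_cancel]
      · intro b hb hbv
        rw [Finset.mem_erase] at hb
        exact hb.1 (hA b hb.2 v hvA hbv)
    · simp [Finset.insert_erase hvA, Finset.union_sdiff_cancel_right hd]

/-- Under `hn` the `r` roots form a transversal. The factor `m + 1` marks an edge, whose removal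
splits one component into `q + 1`. -/
theorem rootedCount_transversal_rec {q : ℕ} (hq : 1 ≤ q) {r m : ℕ}
    (hn : Fintype.card V = r + q * (m + 1)) :
    (m + 1) * rootedCount V q r (m + 1) =
      Fintype.card V * (r + q - 1).choose q * rootedCount V q (r + q) m := by
  have h1 : (m + 1) * rootedCount V q r (m + 1) =
      ∑ F ∈ forests V q (m + 1), ∑ _A ∈ F, (sepSets F r).card := by
    rw [rootedCount, Finset.mul_sum]
    refine Finset.sum_congr rfl fun F hF => ?_
    rw [Finset.sum_const, (mem_forests.1 hF).2.2, smul_eq_mul]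
  rw [h1, sum_forests_succ hq, rootedCount, Finset.mul_sum]
  refine Finset.sum_congr rfl fun F hF => sum_card_sepSets_insert ?_ fun A hA => ?_
  · obtain ⟨hF, hu, hm⟩ := mem_forests.1 hF
    have := card_eq_numComponents_add hF hu
    rw [hm, hn, mul_add] at this
    omega
  · obtain ⟨hF, hu, hm⟩ := mem_forests.1 hF
    obtain ⟨hA, hAc⟩ := mem_sepSets.1 hA
    have hn' : A ∉ F := hA.notMem_edges (by omega)
    have := card_eq_numComponents_add ((isHyperforest_insert_iff hn').2 ⟨hF, hA⟩) (q := q)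
      (fun B hB => by
        rcases Finset.mem_insert.1 hB with rfl | hB
        exacts [hAc, hu B hB])
    rw [Finset.card_insert_of_notMem hn', hm, hn] at this
    omega

end Hyperforest

/-! ### Closed form for fully rooted hyperforests and reduction to it -/

namespace Hyperforest

theorem rootedCount_zero {V : Type*} [Fintype V] (q : ℕ) :
    rootedCount V q (Fintype.card V) 0 = 1 := by
  classical
  have h1 : forests V q 0 = {∅} := by
    ext F
    rw [mem_forests, Finset.mem_singleton, Finset.card_eq_zero]
    refine ⟨fun h => h.2.2, ?_⟩
    rintro rfl
    exact ⟨isHyperforest_empty, by simp, rfl⟩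
  have h2 : sepSets (∅ : Finset (Finset V)) (Fintype.card V) = {Finset.univ} := by
    ext S
    rw [mem_sepSets, Finset.mem_singleton, Finset.card_eq_iff_eq_univ]
    exact ⟨fun h => h.2, fun h => ⟨fun a _ b _ hab => joined_empty_iff.1 hab, h⟩⟩
  simp [rootedCount, h1, h2]

theorem rootedCount_transversal {V : Type*} [Fintype V] {q : ℕ} (hq : 1 ≤ q) (r m : ℕ)
    (hn : Fintype.card V = r + 1 + q * m) :
    rootedCount V q (r + 1) m * (q.factorial ^ m * m.factorial * r.factorial) =
      Fintype.card V ^ m * (Fintype.card V - 1).factorial := by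
  classical
  induction m generalizing r with
  | zero =>
    have h : r + 1 = Fintype.card V := by simpa using hn.symm
    rw [h, rootedCount_zero, ← h]
    simp
  | succ m ih =>
    have h1 := rootedCount_transversal_rec hq hn
    have h2 := ih (r + q) (by rw [hn]; ring)
    have h3 := Nat.add_choose_mul_factorial_mul_factorial r q
    have e1 : r + 1 + q - 1 = r + q := by omega
    have e2 : r + 1 + q = r + q + 1 := by omega
    rw [e1, e2] at h1
    calc _ = ((m + 1) * rootedCount V q (r + 1) (m + 1)) *
          (q.factorial ^ m * q.factorial * m.factorial * r.factorial) := by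
            rw [Nat.factorial_succ m, pow_succ]; ring
      _ = Fintype.card V * (rootedCount V q (r + q + 1) m * (q.factorial ^ m * m.factorial *
          ((r + q).choose q * r.factorial * q.factorial))) := by rw [h1]; ring
      _ = _ := by rw [h3, h2, pow_succ]; ring

theorem sum_choose_succ_mul (b : ℕ → ℝ) (d : ℕ) :
    ∑ j ∈ Finset.range (d + 2), ((d + 1).choose j : ℝ) * b j =
      ∑ j ∈ Finset.range (d + 1), (d.choose j : ℝ) * b j +
        ∑ j ∈ Finset.range (d + 1), (d.choose j : ℝ) * b (j + 1) := by
  have h := Finset.sum_range_succ' (fun j => (d.choose j : ℝ) * b j) (d + 1)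
  rw [Finset.sum_range_succ] at h
  simp only [Nat.choose_succ_self, Nat.cast_zero, zero_mul, add_zero] at h
  rw [Finset.sum_range_succ', h]
  simp only [Nat.choose_succ_succ, Nat.cast_add, add_mul, Finset.sum_add_distrib,
    Nat.choose_zero_right]
  ring

/-- Inclusion of edge-rooted components: counting rooted hyperforests with `d` components without a
root through hyperforests all of whose components are rooted. -/
theorem factorial_mul_rootedCount {V : Type*} [Fintype V] {q : ℕ} (hq : 1 ≤ q) (d r m : ℕ)
    (hdm : d ≤ m) (hn : Fintype.card V = r + d + q * m) :
    (d.factorial : ℝ) * (r.factorial * rootedCount V q r m) =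
      ∑ j ∈ Finset.range (d + 1), (d.choose j : ℝ) * ((-(q / (q + 1).factorial)) ^ j *
        ((r + d + q * j).factorial * rootedCount V q (r + d + q * j) (m - j))) := by
  classical
  induction d generalizing r m with
  | zero => simp
  | succ d ih =>
    obtain ⟨m, rfl⟩ : ∃ m', m = m' + 1 := ⟨m - 1, by omega⟩
    have h1 := ih (r + 1) (m + 1) (by omega) (by rw [hn]; ring)
    have h2 := ih (r + (q + 1)) m (by omega) (by rw [hn]; ring)
    have hrec : ((r : ℝ) + 1) * rootedCount V q (r + 1) (m + 1) +
        (r + q * (m + 1)) * rootedCount V q r (m + 1) =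
        Fintype.card V * rootedCount V q r (m + 1) +
        q * ((r + (q + 1)).choose (q + 1) * rootedCount V q (r + (q + 1)) m) := by
      exact_mod_cast rootedCount_rec (V := V) hq r m
    have hch : ((r + (q + 1)).choose (q + 1) : ℝ) * r.factorial * (q + 1).factorial =
        (r + (q + 1)).factorial := by
      exact_mod_cast Nat.add_choose_mul_factorial_mul_factorial r (q + 1)
    have hq0 : ((q + 1).factorial : ℝ) ≠ 0 := by positivity
    -- By `hn`, `n - r - q (m + 1) = d + 1`. The factor `r!` absorbs `r + 1` and the binomial
    -- coefficient, leaving the constant `-q / (q + 1)!`.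
    have hstep : ((d : ℝ) + 1) * (r.factorial * rootedCount V q r (m + 1)) =
        (r + 1).factorial * rootedCount V q (r + 1) (m + 1) + (-(q / (q + 1).factorial)) *
          ((r + (q + 1)).factorial * rootedCount V q (r + (q + 1)) m) := by
      rw [← hch, Nat.factorial_succ r]
      rw [hn] at hrec
      push_cast at hrec ⊢
      field_simp
      linear_combination -hrec
    rw [sum_choose_succ_mul]
    calc _ = (d.factorial : ℝ) * (((d : ℝ) + 1) * (r.factorial * rootedCount V q r (m + 1))) := by
            rw [Nat.factorial_succ d]; push_cast; ring
      _ = (d.factorial : ℝ) * ((r + 1).factorial * rootedCount V q (r + 1) (m + 1)) +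
          (-(q / (q + 1).factorial)) * ((d.factorial : ℝ) * ((r + (q + 1)).factorial *
            rootedCount V q (r + (q + 1)) m)) := by rw [hstep]; ring
      _ = _ := by
        rw [h1, h2, Finset.mul_sum]
        congr 1
        · refine Finset.sum_congr rfl fun j _ => ?_
          rw [show r + 1 + d + q * j = r + (d + 1) + q * j by ring]
        · refine Finset.sum_congr rfl fun j _ => ?_
          rw [show r + (q + 1) + d + q * j = r + (d + 1) + q * (j + 1) by ring,
            show m + 1 - (j + 1) = m - j by omega]
          ring

theorem rootedCount_one {V : Type*} [Fintype V] (q m : ℕ) :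
    rootedCount V q 1 m = Fintype.card V * (forests V q m).card := by
  classical
  have h : ∀ F : Finset (Finset V), (sepSets F 1).card = Fintype.card V := by
    intro F
    have : sepSets F 1 = Finset.univ.powersetCard 1 := by
      ext S
      rw [mem_sepSets, Finset.mem_powersetCard_univ, Finset.card_eq_one]
      refine ⟨fun h => h.2, ?_⟩
      rintro ⟨a, rfl⟩
      exact ⟨by simp [Separated], a, rfl⟩
    rw [this, Finset.card_powersetCard, Finset.card_univ, Nat.choose_one_right]
  simp [rootedCount, h, mul_comm]

/-- The weight selects uniform hyperforests, and for these `n = p + q m` makes `p` components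
equivalent to `m` edges. -/
theorem unrootedWeight_basisWeight {n p q m : ℕ} (hq : 1 ≤ q) (hn : n = p + q * m) :
    unrootedWeight n p (basisWeight (q + 1)) = (forests (Fin n) q m).card := by
  classical
  have hprod : ∀ F : Finset (Finset (Fin n)), ∏ A ∈ F, basisWeight (q + 1) A.card =
      if ∀ A ∈ F, A.card = q + 1 then (1 : ℝ) else 0 := by
    intro F
    rw [Finset.prod_congr rfl (g := fun A => if A.card = q + 1 then (1 : ℝ) else 0)
      fun A _ => by simp [basisWeight, Pi.single_apply]]
    split_ifs with h
    · exact Finset.prod_eq_one fun A hA => if_pos (h A hA)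
    · push Not at h
      obtain ⟨A, hA, hc⟩ := h
      exact Finset.prod_eq_zero hA (if_neg hc)
  rw [unrootedWeight, Finset.sum_congr rfl fun F _ => hprod F, ← Finset.sum_filter,
    Finset.sum_const, nsmul_eq_mul, mul_one]
  congr 2
  ext F
  simp only [Finset.mem_filter, Finset.mem_powerset, mem_forests]
  constructor
  · rintro ⟨⟨-, hF, hp⟩, hu⟩
    refine ⟨hF, hu, ?_⟩
    have := card_eq_numComponents_add hF hu
    rw [hp, Fintype.card_fin] at this
    exact (Nat.eq_of_mul_eq_mul_left hq (Nat.add_left_cancel (hn.symm.trans this))).symm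
  · rintro ⟨hF, hu, hm⟩
    refine ⟨⟨fun A hA => ?_, hF, ?_⟩, hu⟩
    · simp [completeHyperedges, hu A hA, hq]
    · have := card_eq_numComponents_add hF hu
      rw [hm, Fintype.card_fin] at this
      exact (Nat.add_right_cancel (hn.symm.trans this)).symm

/-! ### The ratio to the leading term and its limit -/

/-- The ratio of the number of hyperforests to the leading term, with `m` the number of edges. -/
noncomputable def correction (q p n m : ℕ) : ℝ :=
  (((q : ℝ) + 1) / q) ^ (p - 1) * ∑ j ∈ Finset.range p, ((p - 1).choose j : ℝ) *
    ((-(q / (q + 1))) ^ j * (p + q * j) * (m.descFactorial j / (n : ℝ) ^ j))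

/-- The expansion with `r = 1` and `d = p - 1` deletes up to `p - 1` edges, whence `p - 1 ≤ m`. -/
theorem unrootedWeight_eq_leadingTerm_mul {n p q m : ℕ} (hq : 1 ≤ q) (hp : 1 ≤ p)
    (hn : n = p + q * m) (hm : p - 1 ≤ m) :
    unrootedWeight n p (basisWeight (q + 1)) = leadingTerm (q + 1) p n * correction q p n m := by
  obtain ⟨d, rfl⟩ : ∃ d, p = d + 1 := ⟨p - 1, by omega⟩
  rw [Nat.add_sub_cancel] at hm
  have hn0 : (n : ℝ) ≠ 0 := by
    have : n ≠ 0 := by omega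
    exact_mod_cast this
  have hq0 : (q : ℝ) ≠ 0 := by
    have : q ≠ 0 := by omega
    exact_mod_cast this
  have hq1 : (q : ℝ) + 1 ≠ 0 := by positivity
  have hqf : (q.factorial : ℝ) ≠ 0 := by positivity
  have hmf : (m.factorial : ℝ) ≠ 0 := by positivity
  have hdf : (d.factorial : ℝ) ≠ 0 := by positivity
  have hnd : n - (d + 1) = q * m := by omega
  have hdiv : q * m / q = m := Nat.mul_div_cancel_left m hq
  have hincl := factorial_mul_rootedCount (V := Fin n) hq d 1 m hm
    (by rw [Fintype.card_fin, hn]; ring)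
  -- In the closed form, `q * q! / (q + 1)! = q / (q + 1)`, the quotient `(1 + d + q j)! / (d + q
  -- j)!` gives the linear factor, and `m! / (m - j)!` the falling factorial.
  have hterm : ∀ j ∈ Finset.range (d + 1), (d.choose j : ℝ) *
      ((-(q / (q + 1).factorial)) ^ j * ((1 + d + q * j).factorial *
        rootedCount (Fin n) q (1 + d + q * j) (m - j))) =
      (n - 1).factorial * n ^ m / (q.factorial ^ m * m.factorial) * ((d.choose j : ℝ) *
        ((-(q / (q + 1))) ^ j * ((d + 1 : ℕ) + q * j) * (m.descFactorial j / (n : ℝ) ^ j))) := by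
    intro j hj
    have hjm : j ≤ m := (Nat.lt_succ_iff.1 (Finset.mem_range.1 hj)).trans hm
    obtain ⟨t, rfl⟩ := Nat.exists_eq_add_of_le hjm
    have htr := rootedCount_transversal (V := Fin n) hq (d + q * j) t
      (by rw [Fintype.card_fin, hn]; ring)
    rw [Fintype.card_fin] at htr
    have htr' : (rootedCount (Fin n) q (d + q * j + 1) t : ℝ) *
        (q.factorial ^ t * t.factorial * (d + q * j).factorial) =
        n ^ t * (n - 1).factorial := by exact_mod_cast htr
    have hde : (t.factorial : ℝ) * (j + t).descFactorial j = (j + t).factorial := by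
      have := Nat.factorial_mul_descFactorial hjm
      rw [Nat.add_sub_cancel_left] at this
      exact_mod_cast this
    have hde0 : ((j + t).descFactorial j : ℝ) ≠ 0 := fun h => hmf (by rw [← hde, h, mul_zero])
    have htf : (t.factorial : ℝ) ≠ 0 := by positivity
    rw [show 1 + d + q * j = d + q * j + 1 by ring, Nat.add_sub_cancel_left, ← hde,
      Nat.factorial_succ (d + q * j), Nat.factorial_succ q, neg_pow, neg_pow ((q : ℝ) / (q + 1))]
    push_cast
    rw [div_pow, div_pow, mul_pow, pow_add, pow_add]
    field_simp
    linear_combination (d.choose j : ℝ) * ((d : ℝ) + q * j + 1) * htr'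
  rw [Finset.sum_congr rfl hterm, ← Finset.mul_sum, rootedCount_one, Fintype.card_fin,
    Nat.cast_mul, ← unrootedWeight_basisWeight hq hn] at hincl
  have hch : ((n - 1).choose d : ℝ) * d.factorial * (q * m).factorial = (n - 1).factorial := by
    have := Nat.add_choose_mul_factorial_mul_factorial (q * m) d
    rw [show q * m + d = n - 1 by omega] at this
    rw [mul_right_comm]
    exact_mod_cast this
  rw [← hch] at hincl
  rw [leadingTerm, correction, Nat.add_sub_cancel, Nat.add_sub_cancel, hnd, hdiv,
    zpow_sub_one₀ hn0, zpow_natCast]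
  push_cast at hincl ⊢
  rw [add_sub_cancel_right, div_pow, div_pow]
  generalize ∑ j ∈ Finset.range (d + 1), (_ : ℝ) = S at hincl ⊢
  field_simp at hincl ⊢
  linear_combination hincl

/-- The sum over `j` in the limit of `correction`. -/
theorem sum_choose_mul_add {x y a : ℝ} {q : ℕ} (hy : 1 + x = y) (hxy : q * x = -y) (d : ℕ) :
    ∑ j ∈ Finset.range (d + 1), (d.choose j : ℝ) * (x ^ j * (a + q * j)) = y ^ d * (a - d) := by
  induction d generalizing a with
  | zero => simp
  | succ d ih =>
    have h : ∀ j ∈ Finset.range (d + 1),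
        (d.choose j : ℝ) * (x ^ (j + 1) * (a + q * ((j + 1 : ℕ) : ℝ))) =
        x * ((d.choose j : ℝ) * (x ^ j * (a + q + q * j))) := by
      intro j _
      push_cast
      ring
    -- Pascal's rule leaves `y ^ d * ((a - d) + x * (a + q - d))`, and the bracket is `(a - d) * y +
    -- q * x = y * (a - d - 1)`.
    rw [sum_choose_succ_mul (fun j => x ^ j * (a + q * j)), Finset.sum_congr rfl h,
      ← Finset.mul_sum, ih, ih]
    push_cast
    rw [pow_succ]
    linear_combination y ^ d * ((a - d) * hy + hxy)

theorem tendsto_div_of_dvd {q p : ℕ} (hq : 1 ≤ q) :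
    Tendsto (fun n : ℕ => (((n - p) / q : ℕ) : ℝ) / n)
      (atTop ⊓ 𝓟 {n : ℕ | p ≤ n ∧ q ∣ n - p}) (nhds ((q : ℝ)⁻¹)) := by
  have hq0 : (q : ℝ) ≠ 0 := by
    have : q ≠ 0 := by omega
    exact_mod_cast this
  have h : Tendsto (fun n : ℕ => (1 - (p : ℝ) / n) * (q : ℝ)⁻¹) atTop (nhds ((1 - 0) * (q : ℝ)⁻¹)) :=
    (tendsto_const_nhds.sub (tendsto_const_div_atTop_nhds_zero_nat (p : ℝ))).mul_const _
  rw [sub_zero, one_mul] at h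
  refine (h.mono_left inf_le_left).congr' ?_
  filter_upwards [(eventually_gt_atTop 0).filter_mono inf_le_left,
    (mem_inf_of_right (mem_principal_self _) : _ ∈ atTop ⊓ 𝓟 {n : ℕ | p ≤ n ∧ q ∣ n - p})]
    with n hn0 hn
  obtain ⟨hpn, m, hm⟩ := hn
  have hn' : (n : ℝ) = p + q * m := by
    have : n = p + q * m := by omega
    exact_mod_cast this
  have hn0' : (n : ℝ) ≠ 0 := by exact_mod_cast hn0.ne'
  rw [hm, Nat.mul_div_cancel_left m hq]
  field_simp
  linear_combination hn'

theorem eventually_le_div {q p : ℕ} (hq : 1 ≤ q) (j : ℕ) : ∀ᶠ n : ℕ in atTop, j ≤ (n - p) / q := by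
  filter_upwards [eventually_ge_atTop (p + j * q)] with n hn
  rw [Nat.le_div_iff_mul_le hq]
  omega

theorem tendsto_descFactorial_div {q p : ℕ} (hq : 1 ≤ q) (j : ℕ) :
    Tendsto (fun n : ℕ => (((n - p) / q).descFactorial j : ℝ) / (n : ℝ) ^ j)
      (atTop ⊓ 𝓟 {n : ℕ | p ≤ n ∧ q ∣ n - p}) (nhds (((q : ℝ)⁻¹) ^ j)) := by
  induction j with
  | zero => simpa using tendsto_const_nhds
  | succ j ih =>
    have h := (((tendsto_div_of_dvd (p := p) hq).sub
      ((tendsto_const_div_atTop_nhds_zero_nat (j : ℝ)).mono_left inf_le_left)).mul ih)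
    rw [sub_zero, ← pow_succ'] at h
    refine h.congr' ?_
    filter_upwards [(eventually_le_div (p := p) hq j).filter_mono inf_le_left] with n hn
    rw [Nat.descFactorial_succ, Nat.cast_mul, Nat.cast_sub hn, pow_succ', ← sub_div,
      div_mul_div_comm]

theorem tendsto_correction {q p : ℕ} (hq : 1 ≤ q) (hp : 1 ≤ p) :
    Tendsto (fun n : ℕ => correction q p n ((n - p) / q))
      (atTop ⊓ 𝓟 {n : ℕ | p ≤ n ∧ q ∣ n - p}) (nhds 1) := by
  obtain ⟨d, rfl⟩ : ∃ d, p = d + 1 := ⟨p - 1, by omega⟩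
  have hq0 : (q : ℝ) ≠ 0 := by
    have : q ≠ 0 := by omega
    exact_mod_cast this
  have hq1 : (q : ℝ) + 1 ≠ 0 := by positivity
  -- The limit `q⁻¹` of `m / n` turns `-q / (q + 1)` into `x = -1 / (q + 1)`. With `a = d + 1` the
  -- sum is `(q / (q + 1)) ^ d`, which the prefactor cancels.
  have hlim : (((q : ℝ) + 1) / q) ^ d * ∑ j ∈ Finset.range (d + 1), (d.choose j : ℝ) *
      ((-(q / (q + 1))) ^ j * ((d + 1 : ℕ) + q * j) * ((q : ℝ)⁻¹) ^ j) = 1 := by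
    have hs := sum_choose_mul_add (x := -(1 / ((q : ℝ) + 1))) (y := q / (q + 1))
      (a := ((d + 1 : ℕ) : ℝ)) (q := q) (by field_simp; ring) (by ring) d
    have hterm : ∀ j ∈ Finset.range (d + 1), (d.choose j : ℝ) *
        ((-(q / (q + 1))) ^ j * ((d + 1 : ℕ) + q * j) * ((q : ℝ)⁻¹) ^ j) =
        (d.choose j : ℝ) * ((-(1 / ((q : ℝ) + 1))) ^ j * ((d + 1 : ℕ) + q * j)) := by
      intro j _
      have hx : -(1 / ((q : ℝ) + 1)) = -(q / (q + 1)) * (q : ℝ)⁻¹ := by field_simp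
      rw [hx, mul_pow]
      ring
    rw [Finset.sum_congr rfl hterm, hs, ← mul_assoc, ← mul_pow]
    push_cast
    rw [div_mul_div_cancel₀ hq0, div_self hq1]
    ring
  rw [← hlim]
  simp only [correction, Nat.add_sub_cancel]
  exact (tendsto_finsetSum _ fun j _ =>
    ((tendsto_descFactorial_div hq j).const_mul _).const_mul _).const_mul _

theorem unrootedWeight_isEquivalent {q p : ℕ} (hq : 1 ≤ q) (hp : 1 ≤ p) :
    (fun n : ℕ => unrootedWeight n p (basisWeight (q + 1)))
      ~[atTop ⊓ 𝓟 {n : ℕ | p ≤ n ∧ q ∣ n - p}] fun n : ℕ => leadingTerm (q + 1) p n := by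
  refine isEquivalent_iff_exists_eq_mul.2
    ⟨fun n => correction q p n ((n - p) / q), tendsto_correction hq hp, ?_⟩
  filter_upwards [(eventually_le_div (p := p) hq (p - 1)).filter_mono inf_le_left,
    (mem_inf_of_right (mem_principal_self _) : _ ∈ atTop ⊓ 𝓟 {n : ℕ | p ≤ n ∧ q ∣ n - p})]
    with n hn hmem
  obtain ⟨hpn, hdvd⟩ := hmem
  have hn' : n = p + q * ((n - p) / q) := by
    rw [Nat.mul_div_cancel' hdvd]
    omega
  rw [Pi.mul_apply, mul_comm]
  exact unrootedWeight_eq_leadingTerm_mul hq hp hn' hn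

theorem leadingTerm_two {p n : ℕ} (hpn : p ≤ n) :
    leadingTerm 2 p n =
      ((n - 1).choose (p - 1) : ℝ) * ((n : ℝ) ^ ((n : ℤ) - (p : ℤ) - 1) / 2 ^ (p - 1)) := by
  have h : ((n - p).factorial : ℝ) ≠ 0 := by positivity
  simp only [leadingTerm, Nat.add_one_sub_one, Nat.div_one, Nat.factorial_one, Nat.cast_one,
    one_pow, div_one, div_self h, Nat.cast_sub hpn, Nat.cast_ofNat]
  rw [show (2 : ℝ) - 1 = 1 by norm_num, div_pow, one_pow]
  ring

end Hyperforest

theorem mainTheorem6 :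
    -- asymptotics for fixed `k` and `p`, as `n → ∞` with `k - 1 ∣ n - p`
    (∀ k p : ℕ, 2 ≤ k → 1 ≤ p →
      (fun n : ℕ => Hyperforest.unrootedWeight n p (Hyperforest.basisWeight k))
        ~[atTop ⊓ 𝓟 {n : ℕ | p ≤ n ∧ (k - 1) ∣ (n - p)}]
      (fun n : ℕ => Hyperforest.leadingTerm k p n)) ∧
    -- exactness for `p = 1`
    (∀ k n : ℕ, 2 ≤ k → 1 ≤ n → (k - 1) ∣ (n - 1) →
      Hyperforest.unrootedWeight n 1 (Hyperforest.basisWeight k)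
        = Hyperforest.leadingTerm k 1 n) ∧
    -- the case `k = 2`: value of the leading term, and the resulting asymptotics
    (∀ p : ℕ, 1 ≤ p →
      (∀ n : ℕ, p ≤ n → Hyperforest.leadingTerm 2 p n
        = ((n - 1).choose (p - 1) : ℝ) * ((n : ℝ) ^ ((n : ℤ) - (p : ℤ) - 1) / 2 ^ (p - 1))) ∧
      (fun n : ℕ => Hyperforest.unrootedWeight n p (Hyperforest.basisWeight 2))
        ~[atTop]
      (fun n : ℕ => ((n - 1).choose (p - 1) : ℝ)
        * ((n : ℝ) ^ ((n : ℤ) - (p : ℤ) - 1) / 2 ^ (p - 1)))) := by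
  refine ⟨fun k p hk hp => ?_, fun k n hk hn hdvd => ?_, fun p hp =>
    ⟨fun n hpn => Hyperforest.leadingTerm_two hpn, ?_⟩⟩
  · obtain ⟨q, rfl⟩ : ∃ q, k = q + 1 := ⟨k - 1, by omega⟩
    exact Hyperforest.unrootedWeight_isEquivalent (by omega) hp
  · obtain ⟨q, rfl⟩ : ∃ q, k = q + 1 := ⟨k - 1, by omega⟩
    obtain ⟨m, hm⟩ := hdvd
    rw [Nat.add_sub_cancel] at hm
    rw [Hyperforest.unrootedWeight_eq_leadingTerm_mul (m := m) (by omega) le_rfl (by omega)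
      (Nat.zero_le m)]
    -- For `p = 1` only `j = 0` occurs, and the correction equals `1`.
    simp [Hyperforest.correction]
  · have h := Hyperforest.unrootedWeight_isEquivalent (q := 1) le_rfl hp
    have hs : {n : ℕ | p ≤ n ∧ 1 ∣ n - p} ∈ (atTop : Filter ℕ) := by
      filter_upwards [eventually_ge_atTop p] with n hn
      exact ⟨hn, one_dvd _⟩
    rw [inf_eq_left.2 (le_principal_iff.2 hs)] at h
    refine h.congr_right ?_
    filter_upwards [eventually_ge_atTop p] with n hn
    exact Hyperforest.leadingTerm_two hn
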